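/- Let $\Gamma=\mathrm{PSL}(2,\mathbf Z)$ act on the hyperbolic plane $\mathbf H^2$ by Möbius transformations and let $X=\mathbf H^2/\Gamma$ be the modular surface. An element $\gamma\in\Gamma$ is hyperbolic if $|\mathrm{Tr}(\gamma)|>2$, and primitive if it is not of the form $\eta^j$ with $\eta\in\Gamma$, $j\ge 2$. The lengths of closed geodesics of $X$ representing (the conjugacy class of) $\gamma$ are the numbers $L>0$ for which there is a unit-speed geodesic $c\colon\mathbf R\to\mathbf H^2$ with $c(t+L)=\gamma c(t)$ for all $t$; if $\gamma$ is hyperbolic there is exactly one such number, written $\ell(c_\gamma)$. The primitive length spectrum $\mathcal L_p(X)$ is the set of all lengths of closed geodesics representing primitive elements of $\Gamma$. A hyperbolic $\gamma\in\Gamma$ with eigenvalue $\lambda_\gamma$ (defined up to sign and inversion), generating the real quadratic field $K_\gamma=\mathbf Q(\lambda_\gamma)$, is absolutely primitive if $\lambda_\gamma$ is a fundamental unit in the group $\mathcal O_{K_\gamma}^1$ of units of norm $1$ of the ring of integers of $K_\gamma$, i.e. if every element of $\mathcal O_{K_\gamma}^1$ is $\pm\lambda_\gamma^j$ for some $j\in\mathbf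 Z$. For a positive integer $m$ let $\eta_m\in\mathrm{PGL}(2,\mathbf Q)$ be the class of $\mathrm{diag}(1,m)$. (1) Let $\gamma\in\Gamma$ be absolutely primitive and $\ell=\ell(c_\gamma)$. For every $k\in\mathbf N$ there is a positive integer $C$ such that $$\{C\ell n : n=1,\dots,k\}\subset\mathcal L_p(X).$$ Moreover $C$ can be chosen so that for each $1\le n\le k$ there is a positive integer $m$ for which $\theta=\eta_m\gamma^{Cn}\eta_m^{-1}$ lies in $\Gamma$, is primitive, and satisfies $\ell(c_\theta)=C\ell n$. (2) Let $\gamma\in\Gamma$ be primitive and hyperbolic and $\ell=\ell(c_\gamma)$. There is a positive integer $D$, depending only on $\gamma$, such that for every $k\in\mathbf N$ there is a positive rational number $C$ with $CD\in\mathbf N$ and $$\{C\ell n : n=1,\dots,k\}\subset\mathcal L_p(X).$$ -/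

import Mathlib

open scoped MatrixGroups UpperHalfPlane NumberField IntermediateField

noncomputable section

namespace ModularSurface

/-- The canonical homomorphism `PSL(2, ℤ) → PGL(2, R)`. -/
def toPGL (R : Type) [CommRing R] : PSL(2, ℤ) →* PGL(2, R) :=
  (Matrix.ProjGenLinGroup.map (Int.castRingHom R)).comp Matrix.ProjectiveSpecialLinearGroup.toPGL

/-- The set of lengths of the closed (orbifold) geodesics on `ℍ / PSL(2, ℤ)` that represent the
conjugacy class of `g`. Such a geodesic lifts to a complete unit-speed geodesic `c` of the
hyperbolic plane (equivalently, to a distance-preserving map `ℝ → ℍ`) which `g` translates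
along itself by the length `L > 0`. Here `g` acts on `ℍ` by its Möbius transformation. -/
def closedGeodesicLengths (g : PSL(2, ℤ)) : Set ℝ :=
  {L | 0 < L ∧ ∃ c : ℝ → ℍ, Isometry c ∧ ∀ t : ℝ, c (t + L) = toPGL ℝ g • c t}

/-- An element of a group is primitive if it is not a proper power. (Such an element has infinite
order, since `g = g ^ (n + 1)` if `g ^ n = 1`, and `1 = 1 ^ 2`.) -/
def IsPrimitive {G : Type*} [Group G] (g : G) : Prop :=
  ∀ (h : G) (j : ℕ), 2 ≤ j → h ^ j ≠ g

/-- The primitive length spectrum of the modular surface `ℍ / PSL(2, ℤ)`, as a set. -/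
def primitiveLengthSpectrum : Set ℝ :=
  {L | ∃ g : PSL(2, ℤ), IsPrimitive g ∧ L ∈ closedGeodesicLengths g}

/-- `g` is hyperbolic: its trace, well defined up to sign, has absolute value greater than `2`. -/
def IsHyperbolic (g : PSL(2, ℤ)) : Prop :=
  ∃ A : SL(2, ℤ), (A : PSL(2, ℤ)) = g ∧ 2 < |(A : Matrix (Fin 2) (Fin 2) ℤ).trace|

/-- The group of units of norm one (over `ℚ`) of the ring of integers of a number field `K`. -/
def normOneUnits (K : Type*) [Field K] [Algebra ℚ K] : Subgroup (𝓞 K)ˣ where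
  carrier := {u | Algebra.norm ℚ ((u : 𝓞 K) : K) = 1}
  mul_mem' := by
    intro a b ha hb
    simp only [Set.mem_ofPred_eq] at ha hb ⊢
    simp [ha, hb]
  one_mem' := by simp
  inv_mem' := by
    intro a ha
    simp only [Set.mem_ofPred_eq] at ha ⊢
    have h : Algebra.norm ℚ ((a : 𝓞 K) : K) * Algebra.norm ℚ (((a⁻¹ : (𝓞 K)ˣ) : 𝓞 K) : K) = 1 := by
      rw [← map_mul, ← map_mul, ← Units.val_mul]
      simp
    simpa [ha] using h

/-- `x` is a fundamental unit in the group of norm-one units of the ring of integers of `ℚ(x)`: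
it belongs to this group, and together with `-1` it generates it. -/
def IsFundamentalNormOneUnit (x : ℝ) : Prop :=
  ∃ ε ∈ normOneUnits ℚ⟮x⟯, (((ε : 𝓞 ℚ⟮x⟯) : ℚ⟮x⟯) : ℝ) = x ∧
    ∀ u ∈ normOneUnits ℚ⟮x⟯, ∃ j : ℤ, u = ε ^ j ∨ u = -ε ^ j

/-- `g` is absolutely primitive: it is hyperbolic, and an eigenvalue of `g` is a fundamental unit
in the group of norm-one units of the real quadratic field it generates. The eigenvalue is well
defined up to sign and inversion, which do not affect the condition. -/
def IsAbsolutelyPrimitive (g : PSL(2, ℤ)) : Prop :=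
  IsHyperbolic g ∧
    ∃ A : SL(2, ℤ), (A : PSL(2, ℤ)) = g ∧
      ∃ x : ℝ, Polynomial.aeval x (A : Matrix (Fin 2) (Fin 2) ℤ).charpoly = 0 ∧
        IsFundamentalNormOneUnit x

/-- The class of the matrix `diag(1, m)` in `PGL(2, ℚ)`. -/
def diagOne (m : ℕ+) : PGL(2, ℚ) :=
  Matrix.ProjGenLinGroup.mk (.mkOfDetNeZero !![1, 0; 0, (m : ℚ)] (by simp))

end ModularSurface

end

/-! Conjugating a matrix by `diag(1, m)` divides its upper right entry by `m` and multiplies the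
lower left one by `m`. Hence a power `γ ^ n` of a hyperbolic `γ`, whose upper right entry `b` is
nonzero, has the conjugate `θ` by `diag(1, |b|)` in `PSL(2, ℤ)`, with upper right entry `±1`. To see
that such a `θ` is primitive, let `θ = ± B ^ j`. By Cayley–Hamilton, `B ^ j = s • B - r • 1`, where
`s` and `r` are the values at `tr B` of two consecutive rescaled Chebyshev polynomials. So `s`
divides `±1`, and `discr (B ^ j) = s ^ 2 * discr B` yields `discr B > 0`, that is, `|tr B| > 2`.
This forces `|s| ≥ j`, hence `j ≤ 1`. Conjugation in `PGL(2, ℝ)` preserves translation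
lengths, so the length of `θ` is `n` times that of `γ`. -/

namespace ModularSurface

open Matrix
open Polynomial.Chebyshev (S)

/-! ### Translations along geodesic lines -/

section TranslatesAlong

/-- `g` translates the unit-speed geodesic line `c` along itself by the signed length `L`. Lines are
encoded as isometric maps `ℝ → X`. -/
structure TranslatesAlong {G X : Type*} [SMul G X] [PseudoEMetricSpace X] (g : G) (c : ℝ → X)
    (L : ℝ) : Prop where
  isometry : Isometry c
  apply_add : ∀ t, c (t + L) = g • c t

variable {G X : Type*} [PseudoMetricSpace X]

namespace TranslatesAlong

lemma reverse [SMul G X] {g : G} {c : ℝ → X} {L : ℝ} (h : TranslatesAlong g c L) :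
    TranslatesAlong g (fun t ↦ c (-t)) (-L) where
  isometry := h.isometry.comp (IsometryEquiv.neg ℝ).isometry
  apply_add t := by rw [neg_add, neg_neg, h.apply_add]

lemma pow [Monoid G] [MulAction G X] {g : G} {c : ℝ → X} {L : ℝ} (h : TranslatesAlong g c L)
    (n : ℕ) : TranslatesAlong (g ^ n) c (n * L) where
  isometry := h.isometry
  apply_add t := by
    induction n with
    | zero => simp
    | succ n ih =>
      rw [pow_succ', mul_smul, ← ih, ← h.apply_add]
      push_cast
      ring_nf

lemma conj [Group G] [MulAction G X] [IsIsometricSMul G X] {g : G} {c : ℝ → X} {L : ℝ}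
    (h : TranslatesAlong g c L) (p : G) :
    TranslatesAlong (p * g * p⁻¹) (fun t ↦ p • c t) L where
  isometry := (isometry_smul X p).comp h.isometry
  apply_add t := by rw [h.apply_add, mul_smul, mul_smul, inv_smul_smul]

lemma dist_smul [SMul G X] {g : G} {c : ℝ → X} {L : ℝ} (h : TranslatesAlong g c L) (t : ℝ) :
    dist (c t) (g • c t) = |L| := by
  rw [← h.apply_add, h.isometry.dist_eq, dist_self_add_right, Real.norm_eq_abs]

/-- The displacements of two points under `g ^ n` differ by a constant independent of `n`, so the
lengths cannot differ. -/
lemma abs_le_abs [Monoid G] [MulAction G X] [IsIsometricSMul G X] {g : G} {c c' : ℝ → X}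
    {L L' : ℝ} (h : TranslatesAlong g c L) (h' : TranslatesAlong g c' L') : |L| ≤ |L'| := by
  have displacement_le (n : ℕ) : n * (|L| - |L'|) ≤ 2 * dist (c 0) (c' 0) := by
    have triangle := dist_triangle4 (c 0) (c' 0) (g ^ n • c' 0) (g ^ n • c 0)
    rw [(h.pow n).dist_smul, (h'.pow n).dist_smul, _root_.dist_smul, dist_comm (c' 0), abs_mul,
      abs_mul, Nat.abs_cast] at triangle
    linarith
  by_contra! hlt
  obtain ⟨n, hn⟩ := exists_lt_nsmul (sub_pos.2 hlt) (2 * dist (c 0) (c' 0))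
  exact hn.not_ge (by simpa only [nsmul_eq_mul] using displacement_le n)

end TranslatesAlong

end TranslatesAlong

/-! ### Hyperbolic isometries of the upper half-plane -/

lemma dist_coe_smul (g : GL (Fin 2) ℝ) (z w : ℍ) :
    dist ((g • z : ℍ) : ℂ) (g • w : ℍ) =
      |g.det.val| * dist (z : ℂ) w /
        (‖UpperHalfPlane.denom g z‖ * ‖UpperHalfPlane.denom g w‖) := by
  have num_mul_denom_sub : UpperHalfPlane.num g z * UpperHalfPlane.denom g w -
      UpperHalfPlane.denom g z * UpperHalfPlane.num g w = (g.det.val : ℂ) * (z - w) := by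
    rw [GeneralLinearGroup.val_det_apply, det_fin_two]
    simp only [UpperHalfPlane.num, UpperHalfPlane.denom]
    push_cast
    ring
  rw [UpperHalfPlane.coe_smul, UpperHalfPlane.coe_smul, dist_eq_norm, dist_eq_norm, ← map_sub,
    UpperHalfPlane.norm_σ,
    div_sub_div _ _ (UpperHalfPlane.denom_ne_zero g z) (UpperHalfPlane.denom_ne_zero g w),
    num_mul_denom_sub, norm_div, norm_mul, norm_mul, Complex.norm_real, Real.norm_eq_abs]

instance isIsometricSMul_GL : IsIsometricSMul (GL (Fin 2) ℝ) ℍ where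
  isometry_smul g := Isometry.of_dist_eq fun z w ↦ by
    apply Real.cosh_strictMonoOn.injOn dist_nonneg dist_nonneg
    have := norm_ne_zero_iff.2 (UpperHalfPlane.denom_ne_zero g z)
    have := norm_ne_zero_iff.2 (UpperHalfPlane.denom_ne_zero g w)
    have := abs_ne_zero.2 g.det.ne_zero
    have := z.im_ne_zero
    have := w.im_ne_zero
    rw [UpperHalfPlane.cosh_dist, UpperHalfPlane.cosh_dist, dist_coe_smul,
      UpperHalfPlane.im_smul_eq_div_normSq, UpperHalfPlane.im_smul_eq_div_normSq,
      Complex.normSq_eq_norm_sq, Complex.normSq_eq_norm_sq]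
    field_simp

instance isIsometricSMul_PGL : IsIsometricSMul PGL(2, ℝ) ℍ where
  isometry_smul g := by
    induction g using ProjGenLinGroup.induction_on with | mk g =>
    simpa only [UpperHalfPlane.pglMk_smul] using isometry_smul ℍ g

/-- The unit-speed parametrization `t ↦ i eᵗ` of the imaginary axis, the common axis of the diagonal
matrices. -/
noncomputable def imaginaryAxis (t : ℝ) : ℍ := ⟨⟨0, Real.exp t⟩, Real.exp_pos t⟩

lemma translatesAlong_imaginaryAxis {g : GL (Fin 2) ℝ} {μ : Fin 2 → ℝ} (hg : g.val = diagonal μ)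
    (hμ : 0 < μ 0 / μ 1) : TranslatesAlong g imaginaryAxis (Real.log (μ 0 / μ 1)) where
  isometry := UpperHalfPlane.isometry_vertical_line 0
  apply_add t := by
    have hμ₁ : μ 1 ≠ 0 := fun h ↦ by simp [h] at hμ
    have hdet : 0 < g.det.val := by
      have : μ 0 * μ 1 = μ 0 / μ 1 * μ 1 ^ 2 := by field_simp
      rw [GeneralLinearGroup.val_det_apply, hg, det_diagonal, Fin.prod_univ_two, this]
      positivity
    apply UpperHalfPlane.ext
    rw [UpperHalfPlane.coe_smul_of_det_pos hdet]
    simp only [UpperHalfPlane.num, UpperHalfPlane.denom, hg, diagonal_apply_eq,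
      diagonal_apply_ne _ zero_ne_one, diagonal_apply_ne _ one_ne_zero, imaginaryAxis,
      Complex.mk_eq_add_mul_I, Real.exp_add, Real.exp_log hμ]
    have : (μ 1 : ℂ) ≠ 0 := mod_cast hμ₁
    push_cast
    simp only [zero_mul, zero_add, add_zero]
    field_simp

lemma exists_mul_eq_mul_diagonal {n K : Type*} [Fintype n] [DecidableEq n] [Field K]
    {M : Matrix n n K} {μ : n → K} (hμ : Function.Injective μ)
    (hroot : ∀ i, M.charpoly.IsRoot (μ i)) : ∃ P : GL n K, M * P.val = P.val * diagonal μ := by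
  have heigen (i : n) : Module.End.HasEigenvalue (toLin' M) (μ i) := by
    rw [Module.End.hasEigenvalue_iff_isRoot_charpoly, charpoly_toLin']
    exact hroot i
  choose v hv using fun i ↦ (heigen i).exists_hasEigenvector
  have hunit : IsUnit (of v)ᵀ := linearIndependent_cols_iff_isUnit.1
    (Module.End.eigenvectors_linearIndependent' _ μ hμ v hv)
  refine ⟨hunit.unit, ?_⟩
  ext i j
  rw [mul_diagonal, mul_apply, mul_comm]
  exact congr_fun (hv j).apply_eq_smul i

lemma exists_isRoot_charpoly_of_isHyperbolic {M : Matrix (Fin 2) (Fin 2) ℝ} (hM : M.IsHyperbolic) :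
    ∃ μ : Fin 2 → ℝ, Function.Injective μ ∧ (∀ i, M.charpoly.IsRoot (μ i)) ∧ μ 0 * μ 1 = M.det := by
  have hsqrt : √M.discr ≠ 0 := (Real.sqrt_pos.2 hM).ne'
  have hsq : √M.discr ^ 2 = M.trace ^ 2 - 4 * M.det := by
    rw [Real.sq_sqrt (le_of_lt hM), discr_fin_two]
  refine ⟨![(M.trace + √M.discr) / 2, (M.trace - √M.discr) / 2], ?_, ?_, ?_⟩
  · rw [injective_pair_iff_ne]
    grind
  · simp only [charpoly_fin_two, Polynomial.IsRoot.def, Fin.forall_fin_two, cons_val_zero,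
      cons_val_one, cons_val_fin_one, Polynomial.eval_add, Polynomial.eval_sub,
      Polynomial.eval_pow, Polynomial.eval_X, Polynomial.eval_mul, Polynomial.eval_C]
    constructor <;> linear_combination hsq / 4
  · simp only [cons_val_zero, cons_val_one, cons_val_fin_one]
    linear_combination -hsq / 4

theorem exists_translatesAlong_of_isHyperbolic {g : GL (Fin 2) ℝ} (hg : g.IsHyperbolic)
    (hdet : 0 < g.val.det) : ∃ c : ℝ → ℍ, ∃ L > 0, TranslatesAlong g c L := by
  obtain ⟨μ, hμ, hroot, hprod⟩ := exists_isRoot_charpoly_of_isHyperbolic hg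
  obtain ⟨P, hP⟩ := exists_mul_eq_mul_diagonal hμ hroot
  have hquot : 0 < μ 0 / μ 1 := by
    rw [← hprod] at hdet
    exact div_pos_iff.2 (mul_pos_iff.1 hdet)
  have hlog : Real.log (μ 0 / μ 1) ≠ 0 :=
    Real.log_ne_zero_of_pos_of_ne_one hquot (div_ne_one_of_ne (hμ.ne zero_ne_one))
  have hdiag : (P⁻¹ * g * P).val = diagonal μ := by
    rw [mul_assoc, Units.val_mul, Units.val_mul, hP, Units.inv_mul_cancel_left]
  have haxis := (translatesAlong_imaginaryAxis hdiag hquot).conj P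
  rw [show P * (P⁻¹ * g * P) * P⁻¹ = g by group] at haxis
  rcases hlog.lt_or_gt with hneg | hpos
  · exact ⟨_, _, neg_pos.2 hneg, haxis.reverse⟩
  · exact ⟨_, _, hpos, haxis⟩

/-! ### Lengths of closed geodesics -/

lemma mem_closedGeodesicLengths {g : PSL(2, ℤ)} {L : ℝ} :
    L ∈ closedGeodesicLengths g ↔ 0 < L ∧ ∃ c : ℝ → ℍ, TranslatesAlong (toPGL ℝ g) c L :=
  and_congr_right fun _ ↦ exists_congr fun _ ↦ ⟨fun h ↦ ⟨h.1, h.2⟩, fun h ↦ ⟨h.1, h.2⟩⟩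

lemma subsingleton_closedGeodesicLengths (g : PSL(2, ℤ)) :
    (closedGeodesicLengths g).Subsingleton := by
  intro L hL L' hL'
  obtain ⟨hpos, c, hc⟩ := mem_closedGeodesicLengths.1 hL
  obtain ⟨hpos', c', hc'⟩ := mem_closedGeodesicLengths.1 hL'
  simpa only [abs_of_pos hpos, abs_of_pos hpos'] using
    (hc.abs_le_abs hc').antisymm (hc'.abs_le_abs hc)

lemma toPGL_coe (R : Type) [CommRing R] (A : SL(2, ℤ)) :
    toPGL R (A : PSL(2, ℤ)) =
      ProjGenLinGroup.mk
        (GeneralLinearGroup.map (Int.castRingHom R) (Matrix.SpecialLinearGroup.toGL A)) :=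
  rfl

lemma toPGL_eq_map_toPGL {R T : Type} [CommRing R] [CommRing T] (f : R →+* T) (g : PSL(2, ℤ)) :
    toPGL T g = ProjGenLinGroup.map f (toPGL R g) := by
  simp only [toPGL, MonoidHom.comp_apply]
  rw [← MonoidHom.comp_apply (ProjGenLinGroup.map f), ← ProjGenLinGroup.map_comp,
    RingHom.eq_intCast' (f.comp _)]

lemma closedGeodesicLengths_eq_of_conj_pow {g θ : PSL(2, ℤ)} {p : PGL(2, ℚ)} {n : ℕ} {ℓ : ℝ}
    (hn : 0 < n) (hθ : toPGL ℚ θ = p * toPGL ℚ g ^ n * p⁻¹)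
    (hℓ : ℓ ∈ closedGeodesicLengths g) : closedGeodesicLengths θ = {n * ℓ} := by
  obtain ⟨hpos, c, hc⟩ := mem_closedGeodesicLengths.1 hℓ
  have hconj : toPGL ℝ θ = ProjGenLinGroup.map (Rat.castHom ℝ) p * toPGL ℝ g ^ n *
      (ProjGenLinGroup.map (Rat.castHom ℝ) p)⁻¹ := by
    rw [toPGL_eq_map_toPGL (Rat.castHom ℝ), hθ, map_mul, map_mul, map_pow, map_inv,
      ← toPGL_eq_map_toPGL]
  exact (subsingleton_closedGeodesicLengths θ).eq_singleton_of_mem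
    (mem_closedGeodesicLengths.2 ⟨by positivity, _, hconj ▸ (hc.pow n).conj _⟩)

lemma discr_eq_trace_sq_sub_four {R : Type*} [CommRing R] {M : Matrix (Fin 2) (Fin 2) R}
    (hM : M.det = 1) : M.discr = M.trace ^ 2 - 4 := by
  rw [discr_fin_two, hM, mul_one]

section LinearOrder

variable {R : Type*} [CommRing R] [LinearOrder R] [IsStrictOrderedRing R]
  {M : Matrix (Fin 2) (Fin 2) R}

lemma isHyperbolic_iff_two_lt_abs_trace (hM : M.det = 1) :
    M.IsHyperbolic ↔ 2 < |M.trace| := by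
  rw [Matrix.IsHyperbolic, discr_eq_trace_sq_sub_four hM, sub_pos,
    show (4 : R) = 2 ^ 2 by norm_num, sq_lt_sq, abs_two]

lemma discr_nonneg_iff_two_le_abs_trace (hM : M.det = 1) : 0 ≤ M.discr ↔ 2 ≤ |M.trace| := by
  rw [discr_eq_trace_sq_sub_four hM, sub_nonneg, show (4 : R) = 2 ^ 2 by norm_num, sq_le_sq,
    abs_two]

end LinearOrder

theorem IsHyperbolic.exists_closedGeodesicLengths_eq_singleton {g : PSL(2, ℤ)}
    (hg : IsHyperbolic g) : ∃ ℓ, closedGeodesicLengths g = {ℓ} := by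
  obtain ⟨A, rfl, hA⟩ := hg
  let Aℝ : SL(2, ℝ) := A.map (Int.castRingHom ℝ)
  have hAℝ : (Aℝ : Matrix (Fin 2) (Fin 2) ℝ).IsHyperbolic := by
    rw [trace_fin_two] at hA
    rw [isHyperbolic_iff_two_lt_abs_trace Aℝ.det_coe, trace_fin_two]
    change 2 < |(A 0 0 : ℝ) + A 1 1|
    exact mod_cast hA
  obtain ⟨c, L, hL, hc⟩ := exists_translatesAlong_of_isHyperbolic
    (g := Matrix.SpecialLinearGroup.toGL Aℝ) hAℝ (by simp)
  exact ⟨L, (subsingleton_closedGeodesicLengths _).eq_singleton_of_mem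
    (mem_closedGeodesicLengths.2 ⟨hL, c, hc.isometry, hc.apply_add⟩)⟩

/-! ### Powers of unimodular matrices -/

section Powers

variable {R : Type*} [CommRing R]

lemma pow_eq_eval_chebyshev_smul_sub {M : Matrix (Fin 2) (Fin 2) R} (hM : M.det = 1) (n : ℕ) :
    M ^ n = (S R (n - 1)).eval M.trace • M - (S R (n - 2)).eval M.trace • 1 := by
  have cayley_hamilton : M * M = M.trace • M - 1 := by
    nontriviality R
    have := M.aeval_self_charpoly
    simp only [charpoly_fin_two, hM, sq, map_one, map_add, map_sub, map_mul, Polynomial.aeval_X,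
      Polynomial.aeval_C, Algebra.smul_def] at this ⊢
    linear_combination (norm := noncomm_ring) this
  induction n with
  | zero => simp
  | succ n ih =>
    have recurrence : (S R n).eval M.trace =
        M.trace * (S R (n - 1)).eval M.trace - (S R (n - 2)).eval M.trace := by
      simp only [Polynomial.Chebyshev.S_eq R n, Polynomial.eval_sub, Polynomial.eval_mul,
        Polynomial.eval_X]
    rw [pow_succ, ih, Matrix.sub_mul, smul_mul_assoc, smul_mul_assoc, one_mul, cayley_hamilton,
      Nat.cast_succ, add_sub_cancel_right, recurrence, show (n + 1 - 2 : ℤ) = n - 1 by ring]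
    module

lemma discr_smul_sub_smul_one (a b : R) (M : Matrix (Fin 2) (Fin 2) R) :
    (a • M - b • 1).discr = a ^ 2 * M.discr := by
  simp only [discr_fin_two, trace_fin_two, det_fin_two, Matrix.sub_apply, Matrix.smul_apply,
    one_apply_eq, one_apply_ne zero_ne_one, one_apply_ne one_ne_zero, smul_eq_mul]
  ring

lemma discr_pow {M : Matrix (Fin 2) (Fin 2) R} (hM : M.det = 1) (n : ℕ) :
    (M ^ n).discr = (S R (n - 1)).eval M.trace ^ 2 * M.discr := by
  rw [pow_eq_eval_chebyshev_smul_sub hM, discr_smul_sub_smul_one]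

lemma pow_apply_zero_one {M : Matrix (Fin 2) (Fin 2) R} (hM : M.det = 1) (n : ℕ) :
    (M ^ n) 0 1 = (S R (n - 1)).eval M.trace * M 0 1 := by
  simp [pow_eq_eval_chebyshev_smul_sub hM]

variable [LinearOrder R] [IsStrictOrderedRing R]

lemma abs_eval_chebyshev_add_one_le {t : R} (ht : 2 ≤ |t|) (n : ℕ) :
    |(S R (n - 1)).eval t| + 1 ≤ |(S R n).eval t| := by
  induction n with
  | zero => simp
  | succ n ih =>
    have recurrence : (S R (n + 1)).eval t = t * (S R n).eval t - (S R (n - 1)).eval t := by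
      simp [Polynomial.Chebyshev.S_add_one]
    have := mul_le_mul_of_nonneg_right ht (abs_nonneg ((S R n).eval t))
    have := abs_sub_abs_le_abs_sub (t * (S R n).eval t) ((S R (n - 1)).eval t)
    push_cast
    rw [add_sub_cancel_right, recurrence]
    rw [abs_mul] at this
    linarith

lemma natCast_le_abs_eval_chebyshev {t : R} (ht : 2 ≤ |t|) (n : ℕ) :
    (n : R) ≤ |(S R (n - 1)).eval t| := by
  induction n with
  | zero => simp
  | succ n ih =>
    have := abs_eval_chebyshev_add_one_le ht n
    push_cast
    rw [add_sub_cancel_right]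
    linarith

end Powers

lemma IsHyperbolic.pow {g : PSL(2, ℤ)} (hg : IsHyperbolic g) {n : ℕ} (hn : n ≠ 0) :
    IsHyperbolic (g ^ n) := by
  obtain ⟨A, rfl, hA⟩ := hg
  refine ⟨A ^ n, rfl, ?_⟩
  have hne : (S ℤ (n - 1)).eval (A : Matrix (Fin 2) (Fin 2) ℤ).trace ≠ 0 :=
    abs_pos.1 ((Nat.cast_pos.2 hn.bot_lt).trans_le (natCast_le_abs_eval_chebyshev hA.le n))
  rw [← isHyperbolic_iff_two_lt_abs_trace (A ^ n).det_coe, Matrix.SpecialLinearGroup.coe_pow,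
    Matrix.IsHyperbolic, discr_pow A.det_coe]
  exact mul_pos (by positivity) ((isHyperbolic_iff_two_lt_abs_trace A.det_coe).2 hA)

/-! ### Primitive elements of the modular group -/

lemma not_isUnit_pow_apply_zero_one {M : Matrix (Fin 2) (Fin 2) ℤ} (hM : M.det = 1) {j : ℕ}
    (hj : 2 ≤ j) (hdiscr : 0 ≤ (M ^ j).discr) : ¬IsUnit ((M ^ j) 0 1) := by
  intro hunit
  rw [pow_apply_zero_one hM] at hunit
  set s := (S ℤ (j - 1)).eval M.trace with hs
  have habs : |s| = 1 := Int.isUnit_iff_abs_eq.1 (isUnit_of_mul_isUnit_left hunit)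
  have htrace : 2 ≤ |M.trace| := by
    rw [discr_pow hM, ← hs, ← sq_abs, habs, one_pow, one_mul] at hdiscr
    exact (discr_nonneg_iff_two_le_abs_trace hM).1 hdiscr
  have : (j : ℤ) ≤ |s| := natCast_le_abs_eval_chebyshev htrace j
  lia

lemma coe_eq_coe_iff {R : Type*} [CommRing R] [NoZeroDivisors R] {A B : SL(2, R)} :
    (A : PSL(2, R)) = B ↔ B = A ∨ B = -A := by
  rw [QuotientGroup.eq, Matrix.SpecialLinearGroup.mem_center_iff, Fintype.card_fin]
  constructor
  · rintro ⟨r, hr, hAB⟩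
    have hB : (B : Matrix (Fin 2) (Fin 2) R) = r • (A : Matrix (Fin 2) (Fin 2) R) := by
      rw [← mul_inv_cancel_left A B, Matrix.SpecialLinearGroup.coe_mul, ← hAB, scalar_apply,
        ← smul_eq_mul_diagonal]
    rcases sq_eq_one_iff.1 hr with rfl | rfl
    · exact .inl (Subtype.ext (by simpa using hB))
    · exact .inr (Subtype.ext (by simpa using hB))
  · rintro (rfl | rfl)
    · exact ⟨1, one_pow 2, by simp⟩
    · exact ⟨-1, neg_one_sq, by simp [← diagonal_neg]⟩

theorem isPrimitive_of_isUnit_apply_zero_one {T : SL(2, ℤ)}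
    (hdiscr : 0 ≤ (T : Matrix (Fin 2) (Fin 2) ℤ).discr) (hunit : IsUnit (T 0 1)) :
    IsPrimitive (T : PSL(2, ℤ)) := by
  intro h j hj hpow
  induction h using QuotientGroup.induction_on with | H B =>
  replace hpow : ((B ^ j : SL(2, ℤ)) : PSL(2, ℤ)) = T := hpow
  apply not_isUnit_pow_apply_zero_one B.det_coe hj
  · rw [discr_eq_trace_sq_sub_four T.det_coe] at hdiscr
    rw [← Matrix.SpecialLinearGroup.coe_pow, discr_eq_trace_sq_sub_four (B ^ j).det_coe]
    rcases coe_eq_coe_iff.1 hpow with rfl | rfl <;> simpa using hdiscr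
  · rcases coe_eq_coe_iff.1 hpow with rfl | rfl <;> simpa using hunit

/-! ### Conjugation by `diag(1, m)` -/

lemma toPGL_eq_conj_diagOne {A T : SL(2, ℤ)} {m : ℕ+} (h₀₀ : T 0 0 = A 0 0)
    (h₀₁ : m * T 0 1 = A 0 1) (h₁₀ : T 1 0 = m * A 1 0) (h₁₁ : T 1 1 = A 1 1) :
    toPGL ℚ T = diagOne m * toPGL ℚ A * (diagOne m)⁻¹ := by
  have h₀₁' : (m : ℚ) * T 0 1 = A 0 1 := mod_cast h₀₁
  rw [eq_mul_inv_iff_mul_eq, toPGL_coe, toPGL_coe, diagOne, ← map_mul, ← map_mul]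
  congr 1
  ext i j
  fin_cases i <;> fin_cases j <;>
    simp [mul_apply, Fin.sum_univ_two, GeneralLinearGroup.mkOfDetNeZero, h₀₀, h₁₀, h₁₁, ← h₀₁',
      mul_comm]

lemma exists_conj_diagOne_isUnit_apply_zero_one {A : SL(2, ℤ)} (hA : A 0 1 ≠ 0) :
    ∃ (m : ℕ+) (T : SL(2, ℤ)), toPGL ℚ T = diagOne m * toPGL ℚ A * (diagOne m)⁻¹ ∧
      (T : Matrix (Fin 2) (Fin 2) ℤ).trace = (A : Matrix (Fin 2) (Fin 2) ℤ).trace ∧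
      IsUnit (T 0 1) := by
  let m : ℕ+ := ⟨(A 0 1).natAbs, Int.natAbs_pos.2 hA⟩
  have hm : (m : ℤ) * (A 0 1).sign = A 0 1 := by
    rw [mul_comm]
    exact Int.sign_mul_natAbs _
  let T : SL(2, ℤ) := ⟨!![A 0 0, (A 0 1).sign; m * A 1 0, A 1 1], by
    have := A.det_coe
    rw [det_fin_two] at this
    rw [det_fin_two_of]
    linear_combination this - A 1 0 * hm⟩
  refine ⟨m, T, toPGL_eq_conj_diagOne rfl hm rfl rfl, ?_, ?_⟩
  · simp [T, trace_fin_two]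
  · exact Int.isUnit_iff_abs_eq.2 (by simp [T, Int.abs_sign_of_ne_zero hA])

lemma apply_zero_one_ne_zero_of_two_lt_abs_trace {M : Matrix (Fin 2) (Fin 2) ℤ} (hM : M.det = 1)
    (htrace : 2 < |M.trace|) : M 0 1 ≠ 0 := by
  intro h₀₁
  rw [det_fin_two, h₀₁, zero_mul, sub_zero] at hM
  rw [trace_fin_two] at htrace
  rcases Int.mul_eq_one_iff_eq_one_or_neg_one.1 hM with ⟨h₀₀, h₁₁⟩ | ⟨h₀₀, h₁₁⟩ <;>
    simp [h₀₀, h₁₁] at htrace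

theorem IsHyperbolic.exists_isPrimitive_conj_diagOne {g : PSL(2, ℤ)} (hg : IsHyperbolic g) :
    ∃ (m : ℕ+) (θ : PSL(2, ℤ)),
      toPGL ℚ θ = diagOne m * toPGL ℚ g * (diagOne m)⁻¹ ∧ IsPrimitive θ := by
  obtain ⟨A, rfl, hA⟩ := hg
  obtain ⟨m, T, hconj, htrace, hunit⟩ := exists_conj_diagOne_isUnit_apply_zero_one
    (apply_zero_one_ne_zero_of_two_lt_abs_trace A.det_coe hA)
  refine ⟨m, T, hconj, isPrimitive_of_isUnit_apply_zero_one ?_ hunit⟩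
  rw [discr_nonneg_iff_two_le_abs_trace T.det_coe, htrace]
  exact hA.le

end ModularSurface

theorem mainTheorem9_general (γ : PSL(2, ℤ)) (hγ : ModularSurface.IsHyperbolic γ) :
    ∃ ℓ : ℝ, ModularSurface.closedGeodesicLengths γ = {ℓ} ∧
      ∀ n : ℕ, 1 ≤ n → ∃ (m : ℕ+) (θ : PSL(2, ℤ)),
        ModularSurface.toPGL ℚ θ =
          ModularSurface.diagOne m * ModularSurface.toPGL ℚ γ ^ n *
            (ModularSurface.diagOne m)⁻¹ ∧
        ModularSurface.IsPrimitive θ ∧ ModularSurface.closedGeodesicLengths θ = {n * ℓ} := by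
  obtain ⟨ℓ, hℓ⟩ := hγ.exists_closedGeodesicLengths_eq_singleton
  refine ⟨ℓ, hℓ, fun n hn ↦ ?_⟩
  obtain ⟨m, θ, hθ, hprim⟩ :=
    (hγ.pow (Nat.one_le_iff_ne_zero.1 hn)).exists_isPrimitive_conj_diagOne
  rw [map_pow] at hθ
  exact ⟨m, θ, hθ, hprim, ModularSurface.closedGeodesicLengths_eq_of_conj_pow hn hθ (hℓ ▸ rfl)⟩

theorem mainTheorem9 :
    (∀ γ : PSL(2, ℤ), ModularSurface.IsAbsolutelyPrimitive γ →
      ∃ ℓ : ℝ, ModularSurface.closedGeodesicLengths γ = {ℓ} ∧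
        ∀ k : ℕ, ∃ C : ℕ, 0 < C ∧
          ∀ n : ℕ, 1 ≤ n → n ≤ k →
            (C : ℝ) * ℓ * n ∈ ModularSurface.primitiveLengthSpectrum ∧
            ∃ (m : ℕ+) (θ : PSL(2, ℤ)),
              ModularSurface.toPGL ℚ θ =
                ModularSurface.diagOne m * ModularSurface.toPGL ℚ γ ^ (C * n) *
                  (ModularSurface.diagOne m)⁻¹ ∧
              ModularSurface.IsPrimitive θ ∧
              (C : ℝ) * ℓ * n ∈ ModularSurface.closedGeodesicLengths θ) ∧
    (∀ γ : PSL(2, ℤ), ModularSurface.IsHyperbolic γ → ModularSurface.IsPrimitive γ →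
      ∃ ℓ : ℝ, ModularSurface.closedGeodesicLengths γ = {ℓ} ∧
        ∃ D : ℕ, 0 < D ∧
          ∀ k : ℕ, ∃ C : ℚ, 0 < C ∧ (∃ N : ℕ, C * D = N) ∧
            ∀ n : ℕ, 1 ≤ n → n ≤ k →
              (C : ℝ) * ℓ * n ∈ ModularSurface.primitiveLengthSpectrum) := by
  refine ⟨fun γ hγ ↦ ?_, fun γ hγ _ ↦ ?_⟩
  · obtain ⟨ℓ, hℓ, h⟩ := mainTheorem9_general γ hγ.1
    refine ⟨ℓ, hℓ, fun k ↦ ⟨1, one_pos, fun n hn _ ↦ ?_⟩⟩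
    obtain ⟨m, θ, hθ, hprim, hlen⟩ := h n hn
    simp only [Nat.cast_one, one_mul, mul_comm ℓ]
    exact ⟨⟨θ, hprim, hlen ▸ rfl⟩, m, θ, hθ, hprim, hlen ▸ rfl⟩
  · obtain ⟨ℓ, hℓ, h⟩ := mainTheorem9_general γ hγ
    refine ⟨ℓ, hℓ, 1, one_pos, fun k ↦ ⟨1, one_pos, ⟨1, by simp⟩, fun n hn _ ↦ ?_⟩⟩
    obtain ⟨m, θ, -, hprim, hlen⟩ := h n hn
    exact ⟨θ, hprim, by simp [hlen, mul_comm]⟩
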